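/- Let $p$ be an odd prime, let $m,k$ be positive integers, $e=\gcd(m,k)$ and $s=m/e$, and suppose that $s$ is odd, $s\ge 3$, and $k/e$ is odd. Let $\pi$ be a primitive element of $\mathrm{GF}(p^m)$, and let $h_1(x)$ and $h_2(x)$ be the minimal polynomials over $\mathrm{GF}(p)$ of $(-\pi)^{-1}$ and $\pi^{-(p^k+1)/2}$, respectively. Then $h_1(x)h_2(x)$ divides $x^{p^m-1}-1$. Let $\mathcal C$ be the cyclic code over $\mathrm{GF}(p)$ of length $n=p^m-1$ with parity-check polynomial $h_1(x)h_2(x)$, that is, the ideal of $\mathrm{GF}(p)[x]/(x^n-1)$ generated by $(x^n-1)/(h_1(x)h_2(x))$, where $(c_0,\dots,c_{n-1})\in\mathrm{GF}(p)^n$ is identified with $c_0+c_1x+\cdots+c_{n-1}x^{n-1}$. Then $\mathcal C$ is a cyclic code in which exactly three nonzero Hamming weights occur, with parameters $[p^m-1,\ 2m,\ p^m-p^{m-1}-(p-1)p^{(m+e-2)/2}]$ (length, dimension, minimum distance). Its weight distribution is as follows: weight $0$ occurs once; weight $p^m-p^{m-1}-(p-1)p^{(m+e-2)/2}$ occurs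 $\frac12\left(p^{m-e}+p^{(m-e)/2}\right)(p^m-1)$ times; weight $p^m-p^{m-1}$ occurs $\left(p^m-p^{m-e}+1\right)(p^m-1)$ times; weight $p^m-p^{m-1}+(p-1)p^{(m+e-2)/2}$ occurs $\frac12\left(p^{m-e}-p^{(m-e)/2}\right)(p^m-1)$ times; no other weight occurs. -/

import Mathlib

open Polynomial

/-- The linear identification of a vector `(c_0, …, c_{n-1})` over `F` with the class of
`c_0 + c_1 x + ⋯ + c_{n-1} x^{n-1}` in `F[x] / (x^n - 1)`. -/
noncomputable def codewordClass (F : Type*) [Field F] (n : ℕ) :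
    (Fin n → F) →ₗ[F] F[X] ⧸ Ideal.span {(X ^ n - 1 : F[X])} :=
  (Ideal.Quotient.mkₐ F (Ideal.span {(X ^ n - 1 : F[X])})).toLinearMap ∘ₗ
    ∑ i : Fin n, monomial (i : ℕ) ∘ₗ LinearMap.proj i

/-- The cyclic code of length `n` over `F` with parity-check polynomial `h`: the vectors whose
class lies in the ideal of `F[x] / (x^n - 1)` generated by `g = (x^n - 1) / h`
(meaningful when `h` divides `x^n - 1`). -/
noncomputable def cyclicCodeOfParityCheck (F : Type*) [Field F] (n : ℕ) (h : F[X]) :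
    Submodule F (Fin n → F) :=
  ((Ideal.span {Ideal.Quotient.mk (Ideal.span {(X ^ n - 1 : F[X])}) ((X ^ n - 1) / h)}
    ).restrictScalars F).comap (codewordClass F n)

/-- `C` is closed under the shift `(c_0, c_1, …, c_{n-1}) ↦ (c_{n-1}, c_0, …, c_{n-2})`. -/
def IsCyclicCode {F : Type*} [Field F] {n : ℕ} (C : Submodule F (Fin n → F)) : Prop :=
  ∀ c ∈ C, (fun i => c ((finRotate n).symm i)) ∈ C

/-- `C` is an `[n, l, d]` linear code: dimension `l` and minimum Hamming distance `d`. -/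
def HasCodeParameters {F : Type*} [Field F] [DecidableEq F] {n : ℕ}
    (C : Submodule F (Fin n → F)) (l d : ℕ) : Prop :=
  Module.finrank F C = l ∧
    IsLeast {t : ℕ | ∃ u ∈ C, ∃ v ∈ C, u ≠ v ∧ hammingDist u v = t} d

/-- `A_w`: the number of codewords of `C` of Hamming weight `w`. -/
noncomputable def weightCount {F : Type*} [Field F] [DecidableEq F] {n : ℕ}
    (C : Submodule F (Fin n → F)) (w : ℕ) : ℕ :=
  {c : Fin n → F | c ∈ C ∧ hammingNorm c = w}.ncard

/-- `C` is a three-weight code: exactly three nonzero Hamming weights occur in `C`. -/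
def IsThreeWeightCode {F : Type*} [Field F] [DecidableEq F] {n : ℕ}
    (C : Submodule F (Fin n → F)) : Prop :=
  {w : ℕ | w ≠ 0 ∧ ∃ c ∈ C, hammingNorm c = w}.ncard = 3

/-- The product `h₁ h₂` of the minimal polynomials over `GF(p)` of `(-π)⁻¹` and of
`π ^ (-(p^k + 1) / 2)`. -/
noncomputable def zhouDingParityCheck (p k : ℕ) [Fact p.Prime] {K : Type*} [Field K]
    [Algebra (ZMod p) K] (π : K) : (ZMod p)[X] :=
  minpoly (ZMod p) (-π)⁻¹ * minpoly (ZMod p) (π ^ ((p ^ k + 1) / 2))⁻¹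

/-- The cyclic code over `GF(p)` of length `p^m - 1` with parity-check polynomial `h₁ h₂`. -/
noncomputable def zhouDingCode (p m k : ℕ) [Fact p.Prime] {K : Type*} [Field K]
    [Algebra (ZMod p) K] (π : K) : Submodule (ZMod p) (Fin (p ^ m - 1) → ZMod p) :=
  cyclicCodeOfParityCheck (ZMod p) (p ^ m - 1) (zhouDingParityCheck p k π)

/-! Write `P = p ^ k`, `e = gcd(m, k)`, `q = p ^ e`, `E = GF(q)`, `s = [K : E]`, and let `η` be the
quadratic character of `K`. Since `η(π ^ i) = (-1) ^ i`, the `i`-th coordinate of the word of `(a,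
b)` is, up to sign, `Tr (a x + b θ(x))` with `x = π ^ i` and `θ(x) = η(x) x ^ ((P + 1) / 2)`. Its
weight is thus determined by the sums `S(t) = ∑ x, ψ (t (a x + b θ(x)))`.

Take a nonsquare `l` of `E`. As `s` and `k / e` are odd, `l` stays nonsquare in `K` and `θ(l y²) = l
y ^ (P + 1)`. Substituting `x = y²` and `x = l y²` turns `2 S(t)` into two quadratic sums, for `t Q`
and `t l Q`, where `Q(y) = Tr_{K/E} (a y² + b y σ(y))` and `σ(y) = y ^ P` generates the Galois group
of `K / E`. The radical of `Q` solves a `σ`-polynomial of degree two, so it has dimension at most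
two. If the rank is odd, the two sums cancel; if it is even, oddness of `s` forces a radical of
dimension one. Hence `S(t) = ε p ^ ((m + e) / 2)` with `ε ∈ {0, 1, -1}` independent of `t ≠ 0`
(`walshSum_eq`).

Orthogonality gives the sums of `ε` and `ε²` over all `(a, b) ≠ 0`, which fix the three frequencies.
All nonzero pairs have positive weight, so the trace words form a space of dimension `2 m`; the
degree of `h₁ h₂` shows that they fill the code. -/

section QuadraticSums

/-! ### Quadratic forms given by traces, and their exponential sums -/

variable {E K : Type*} [Field E] [Field K] [Algebra E K]

/-- The solutions of a linear `σ`-polynomial equation of degree two form a space of dimension at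
most two over the fixed field of `σ`. -/
theorem finrank_le_two_of_sigma_polynomial [FiniteDimensional E K] (σ : K ≃ₐ[E] K)
    (hσ : ∀ x, σ x = x → x ∈ Set.range (algebraMap E K)) {A B C : K} (hA : A ≠ 0)
    (N : Submodule E K) (hN : ∀ y ∈ N, A * σ (σ y) + B * σ y + C * y = 0) :
    Module.finrank E N ≤ 2 := by
  by_cases hbot : N = ⊥
  · subst hbot; simp
  obtain ⟨y₁, hy₁, hne⟩ := N.ne_bot_iff.mp hbot
  have hs1 : σ y₁ ≠ 0 := by simpa using hne
  have hs2 : σ (σ y₁) ≠ 0 := by simpa using hne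
  -- Reduction of order: for `z = y / y₁`, the difference `σ z - z` satisfies a first-order
  -- equation, and it vanishes only for `y ∈ E y₁`.
  let D : K →ₗ[E] K := (σ.toLinearMap - LinearMap.id) ∘ₗ LinearMap.mulLeft E y₁⁻¹
  have hD : ∀ y, D y = σ (y₁⁻¹ * y) - y₁⁻¹ * y := fun y => rfl
  have hrel : ∀ y ∈ N, A * σ (σ y₁) * σ (D y) = C * y₁ * D y := by
    intro y hy
    have h1 := hN y hy
    have h0 := hN y₁ hy₁
    set z := y₁⁻¹ * y with hz
    have hyz : y = y₁ * z := by rw [hz]; field_simp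
    rw [hyz] at h1
    simp only [map_mul] at h1
    rw [hD, ← hz, map_sub]
    linear_combination h1 - σ z * h0
  let φ := D.domRestrict N
  have hrn := φ.finrank_range_add_finrank_ker
  have hr : Module.finrank E φ.range ≤ 1 := by
    by_cases hb : φ.range = ⊥
    · rw [hb]; simp
    obtain ⟨w₀, hw₀, hw₀ne⟩ := (Submodule.ne_bot_iff _).mp hb
    refine finrank_le_one (⟨w₀, hw₀⟩ : φ.range) ?_
    rintro ⟨w, hw⟩
    have key : ∀ w ∈ φ.range, A * σ (σ y₁) * σ w = C * y₁ * w := by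
      rintro _ ⟨y, rfl⟩
      exact hrel y y.2
    have hk0 := key w₀ hw₀
    have hk := key w hw
    have hs0 : σ w₀ ≠ 0 := by simpa using hw₀ne
    -- The ratio of two solutions of the first-order equation is fixed by `σ`.
    have hfix : σ (w / w₀) = w / w₀ := by
      rw [map_div₀, div_eq_div_iff hs0 hw₀ne]
      have : A * σ (σ y₁) * (σ w * w₀) = A * σ (σ y₁) * (w * σ w₀) := by
        linear_combination w₀ * hk - w * hk0
      exact mul_left_cancel₀ (mul_ne_zero hA hs2) this
    obtain ⟨c, hc⟩ := hσ _ hfix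
    refine ⟨c, Subtype.ext ?_⟩
    simp only [SetLike.val_smul, Algebra.smul_def, hc]
    field_simp
  have hk : Module.finrank E φ.ker ≤ 1 := by
    refine finrank_le_one (⟨⟨y₁, hy₁⟩, ?_⟩ : φ.ker) ?_
    · change D y₁ = 0
      rw [hD]; simp [hne]
    · rintro ⟨⟨y, hy⟩, hyk⟩
      have hyk' : D y = 0 := hyk
      rw [hD, sub_eq_zero] at hyk'
      obtain ⟨c, hc⟩ := hσ _ hyk'
      refine ⟨c, Subtype.ext (Subtype.ext ?_)⟩
      simp only [SetLike.val_smul, Algebra.smul_def, hc]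
      field_simp
  omega

/-- The quadratic form `y ↦ Tr (a y² + b y σ(y))`. -/
noncomputable def traceQuadraticForm (σ : K ≃ₐ[E] K) (a b : K) : QuadraticForm E K :=
  LinearMap.BilinMap.toQuadraticMap ((Algebra.traceForm E K).compl₂
    (LinearMap.mulLeft E a + LinearMap.mulLeft E b ∘ₗ σ.toLinearMap))

theorem traceQuadraticForm_apply (σ : K ≃ₐ[E] K) (a b y : K) :
    traceQuadraticForm σ a b y = Algebra.trace E K (a * y ^ 2 + b * (y * σ y)) := by
  simp only [traceQuadraticForm, LinearMap.BilinMap.toQuadraticMap_apply, LinearMap.compl₂_apply,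
    Algebra.traceForm_apply, LinearMap.add_apply, LinearMap.mulLeft_apply, LinearMap.comp_apply,
    AlgEquiv.toLinearMap_apply]
  congr 1; ring

/-- The trace is `σ`-invariant: applying `σ` to the terms of the polar form that contain `z` makes
`σ z` a common factor, and the trace form is nondegenerate. -/
theorem sigma_polynomial_of_polar_eq_zero [FiniteDimensional E K] [Algebra.IsSeparable E K]
    (σ : K ≃ₐ[E] K) (a b y : K)
    (h : ∀ z, QuadraticMap.polar (traceQuadraticForm σ a b) y z = 0) :
    σ b * σ (σ y) + 2 * σ a * σ y + b * y = 0 := by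
  refine (traceForm_nondegenerate E K).1 _ fun z' => ?_
  obtain ⟨z, rfl⟩ := σ.surjective z'
  have h1 := h z
  rw [traceQuadraticForm, LinearMap.BilinMap.polar_toQuadraticMap] at h1
  simp only [LinearMap.compl₂_apply, Algebra.traceForm_apply, LinearMap.add_apply,
    LinearMap.mulLeft_apply, LinearMap.comp_apply, AlgEquiv.toLinearMap_apply, ← map_add] at h1 ⊢
  have h2 : Algebra.trace E K (2 * a * y * z + b * z * σ y)
      = Algebra.trace E K (2 * σ a * σ y * σ z + σ b * σ z * σ (σ y)) := by
    rw [← Algebra.trace_eq_of_algEquiv σ (2 * a * y * z + b * z * σ y)]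
    simp [map_ofNat σ 2]
  rw [← h1]
  have e1 : y * (a * z + b * σ z) + z * (a * y + b * σ y)
      = (2 * a * y * z + b * z * σ y) + b * y * σ z := by ring
  rw [e1, map_add (Algebra.trace E K), h2, ← map_add (Algebra.trace E K)]
  congr 1; ring

/-- Basis vectors of weight zero lie in the radical, hence in the solution space of the
`σ`-polynomial. -/
theorem card_zero_weights_le_two [FiniteDimensional E K] [Algebra.IsSeparable E K]
    (h2 : (2 : E) ≠ 0) (σ : K ≃ₐ[E] K)
    (hσ : ∀ x, σ x = x → x ∈ Set.range (algebraMap E K)) {a b : K} (hab : (a, b) ≠ 0)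
    {ι : Type*} [Fintype ι] (w : ι → E)
    (hw : (traceQuadraticForm σ a b).Equivalent (QuadraticMap.weightedSumSquares E w)) :
    Nat.card {i // w i = 0} ≤ 2 := by
  classical
  obtain ⟨f⟩ := hw
  let N : Submodule E K :=
    { carrier := {y | σ b * σ (σ y) + 2 * σ a * σ y + b * y = 0}
      add_mem' := fun {x y} hx hy => by
        simp only [Set.mem_ofPred_eq, map_add] at *
        linear_combination hx + hy
      zero_mem' := by simp
      smul_mem' := fun c x hx => by
        simp only [Set.mem_ofPred_eq, Algebra.smul_def, map_mul, AlgEquiv.commutes] at *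
        linear_combination (algebraMap E K c) * hx }
  have hN : Module.finrank E N ≤ 2 := by
    -- For `b = 0` the equation degenerates to `2 σ(a) σ(y) = 0`, which has only the zero solution.
    by_cases hb : b = 0
    · have ha : a ≠ 0 := by rintro rfl; exact hab (by simp [hb])
      have h2' : (2 : K) ≠ 0 := by
        intro h; apply h2; apply (algebraMap E K).injective
        rw [map_ofNat, map_zero]; exact h
      have : N = ⊥ := by
        rw [eq_bot_iff]
        intro y hy
        have : σ b * σ (σ y) + 2 * σ a * σ y + b * y = 0 := hy
        simpa [hb, h2', ha] using this
      rw [this]; simp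
    · exact finrank_le_two_of_sigma_polynomial σ hσ (A := σ b) (by simpa using hb) N fun y hy => hy
  have hmem : ∀ i : {i // w i = 0}, f.toLinearEquiv.symm (Pi.single i.1 1) ∈ N := by
    intro i
    refine sigma_polynomial_of_polar_eq_zero σ a b _ fun z => ?_
    obtain ⟨v, rfl⟩ := f.toLinearEquiv.symm.surjective z
    have hQ : ∀ v, traceQuadraticForm σ a b (f.toLinearEquiv.symm v)
        = QuadraticMap.weightedSumSquares E w v := by
      intro v
      have := f.map_app (f.toLinearEquiv.symm v)
      rw [← this]; congr 1
      exact f.toLinearEquiv.apply_symm_apply v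
    rw [QuadraticMap.polar, ← map_add, hQ, hQ, hQ]
    simp only [QuadraticMap.weightedSumSquares_apply, ← Finset.sum_sub_distrib, Pi.add_apply]
    refine Finset.sum_eq_zero fun j _ => ?_
    by_cases hj : j = i.1
    · subst hj; simp [i.2]
    · simp [Pi.single_eq_of_ne hj]
  have hli : LinearIndependent E (fun i : {i // w i = 0} =>
      (⟨f.toLinearEquiv.symm (Pi.single i.1 1), hmem i⟩ : N)) := by
    apply LinearIndependent.of_comp N.subtype
    have := (Pi.basisFun E ι).linearIndependent.map' f.toLinearEquiv.symm.toLinearMap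
      (LinearEquiv.ker _)
    have := this.comp (Subtype.val : {i // w i = 0} → ι) Subtype.val_injective
    have heq : (N.subtype ∘ fun i : {i // w i = 0} =>
        (⟨f.toLinearEquiv.symm (Pi.single i.1 1), hmem i⟩ : N))
        = (⇑f.toLinearEquiv.symm.toLinearMap ∘ ⇑(Pi.basisFun E ι)) ∘ Subtype.val := by
      ext i
      simp [Pi.basisFun_apply]
    rw [heq]
    exact this
  have := hli.fintype_card_le_finrank
  rw [Nat.card_eq_fintype_card]
  omega

variable [Fintype E] [DecidableEq E]

/-- The quadratic character with complex values. -/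
noncomputable def complexQuadraticChar (E : Type*) [Field E] [Fintype E] [DecidableEq E] :
    MulChar E ℂ := (quadraticChar E).ringHomComp (Int.castRingHom ℂ)

theorem sum_sq_eq_sum_quadraticChar (hE : ringChar E ≠ 2) (F : E → ℂ) :
    ∑ x, F (x ^ 2) = ∑ z, (1 + (quadraticChar E z : ℂ)) * F z := by
  rw [← Finset.sum_fiberwise_of_maps_to (s := Finset.univ) (t := Finset.univ)
    (g := fun x : E => x ^ 2) (fun _ _ => Finset.mem_univ _)]
  refine Finset.sum_congr rfl fun z _ => ?_
  rw [Finset.sum_congr rfl (g := fun _ => F z)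
    (fun x hx => by rw [(Finset.mem_filter.mp hx).2]), Finset.sum_const, nsmul_eq_mul]
  congr 1
  have := quadraticChar_card_sqrts hE z
  have h2 : ({x : E | x ^ 2 = z}.toFinset) = Finset.univ.filter (fun x => x ^ 2 = z) := by
    ext; simp
  rw [h2] at this
  have h3 : (((Finset.univ.filter (fun x : E => x ^ 2 = z)).card : ℤ) : ℂ)
      = ((quadraticChar E z + 1 : ℤ) : ℂ) := by rw [this]
  push_cast at h3
  rw [h3]; ring

theorem sum_addChar_mul_sq (hE : ringChar E ≠ 2) {ψ : AddChar E ℂ} (hψ : ψ.IsPrimitive) {u : E}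
    (hu : u ≠ 0) :
    ∑ x, ψ (u * x ^ 2) = (quadraticChar E u : ℂ) * gaussSum (complexQuadraticChar E) ψ := by
  rw [sum_sq_eq_sum_quadraticChar hE (fun z => ψ (u * z))]
  simp only [add_mul, one_mul, Finset.sum_add_distrib]
  have h0 : ∑ x, ψ (u * x) = 0 := by
    have := AddChar.sum_mulShift u hψ
    simpa [hu, mul_comm] using this
  have h1 := gaussSum_mulShift (complexQuadraticChar E) ψ (Units.mk0 u hu)
  have h2 : (quadraticChar E u : ℂ) * (quadraticChar E u : ℂ) = 1 := by
    have := quadraticChar_sq_one hu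
    rw [← pow_two]; exact_mod_cast this
  rw [h0, zero_add, ← h1, ← mul_assoc]
  have h3 : (complexQuadraticChar E) (Units.mk0 u hu : Eˣ) = (quadraticChar E u : ℂ) := by
    simp [complexQuadraticChar]
  rw [h3, h2, one_mul]
  simp [gaussSum, complexQuadraticChar, AddChar.mulShift_apply]

theorem gaussSum_complexQuadraticChar_sq (hE : ringChar E ≠ 2) {ψ : AddChar E ℂ}
    (hψ : ψ.IsPrimitive) :
    gaussSum (complexQuadraticChar E) ψ ^ 2 = (quadraticChar E (-1) : ℂ) * Fintype.card E := by
  rw [gaussSum_sq _ _ hψ]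
  · simp [complexQuadraticChar]
  · intro h
    apply quadraticChar_ne_one hE
    apply MulChar.injective_ringHomComp (f := Int.castRingHom ℂ) Int.cast_injective
    change complexQuadraticChar E = _
    rw [h]; exact (MulChar.ringHomComp_one _).symm
  · exact (quadraticChar_isQuadratic E).comp _

theorem sum_addChar_quadraticForm {V : Type*} [AddCommGroup V] [Module E V] [Fintype V]
    {ι : Type*} [Fintype ι] [DecidableEq ι] (Q : QuadraticForm E V) (w : ι → E)
    (hw : Q.Equivalent (QuadraticMap.weightedSumSquares E w)) (ψ : AddChar E ℂ) (c : E) :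
    ∑ y, ψ (c * Q y) = ∏ i, ∑ x, ψ (c * w i * x ^ 2) := by
  obtain ⟨f⟩ := hw
  rw [Finset.prod_univ_sum, Fintype.piFinset_univ,
    ← Equiv.sum_comp f.toLinearEquiv.toEquiv]
  refine Finset.sum_congr rfl fun y _ => ?_
  have : Q y = QuadraticMap.weightedSumSquares E w (f.toLinearEquiv.toEquiv y) := (f.map_app y).symm
  rw [this, QuadraticMap.weightedSumSquares_apply, Finset.mul_sum]
  refine (map_prod ψ.toMonoidHom (fun i => Multiplicative.ofAdd
    (c * w i • (f.toLinearEquiv.toEquiv y i * f.toLinearEquiv.toEquiv y i))) _).trans ?_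
  refine Finset.prod_congr rfl fun i _ => ?_
  rw [AddChar.toMonoidHom_apply, toAdd_ofAdd, smul_eq_mul]
  congr 1; ring

/-- With `n = [K : E]`, `q = |E|`, rank `r`, Gauss sum `G` and `δ = ∏ η(wᵢ)` over nonzero weights,
the first sum is `q ^ (n - r) η(c) ^ r δ G ^ r`; the second is `(-1) ^ r` times it. For even `r`, `n
- r ≤ 2` and `n` odd give `n - r = 1`; `η(c) ^ r = 1` removes the dependence on `c`, and `G² = η(-1)
q`. -/
theorem sum_add_sum_addChar_traceQuadraticForm [Fintype K] (hE : ringChar E ≠ 2)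
    (hodd : Odd (Module.finrank E K)) (σ : K ≃ₐ[E] K)
    (hσ : ∀ x, σ x = x → x ∈ Set.range (algebraMap E K)) {a b : K} (hab : (a, b) ≠ 0)
    {ψ : AddChar E ℂ} (hψ : ψ.IsPrimitive) {l : E} (hl : ¬ IsSquare l) :
    ∃ ε : ℤ, (ε = 0 ∨ ε = 1 ∨ ε = -1) ∧ ∀ c : E, c ≠ 0 →
      ∑ y, ψ (c * traceQuadraticForm σ a b y) + ∑ y, ψ (c * l * traceQuadraticForm σ a b y)
        = 2 * ε * (Fintype.card E : ℂ) ^ ((Module.finrank E K + 1) / 2) := by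
  classical
  have h2 : (2 : E) ≠ 0 := Ring.two_ne_zero hE
  have : Invertible (2 : E) := invertibleOfNonzero h2
  have hl0 : l ≠ 0 := by rintro rfl; exact hl (by simp)
  have hηl : quadraticChar E l = -1 := quadraticChar_neg_one_iff_not_isSquare.mpr hl
  obtain ⟨w, hw⟩ := QuadraticForm.equivalent_weightedSumSquares (traceQuadraticForm σ a b)
  have hz := card_zero_weights_le_two h2 σ hσ hab w hw
  set Z := Finset.univ.filter (fun i => w i = 0) with hZ
  set R := Finset.univ.filter (fun i => ¬ w i = 0) with hR
  have hzc : Z.card ≤ 2 := by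
    rw [Nat.card_eq_fintype_card, Fintype.card_subtype] at hz
    exact hz
  have hcard : Z.card + R.card = Module.finrank E K := by
    rw [hZ, hR, Finset.card_filter_add_card_filter_not]; simp
  set G := gaussSum (complexQuadraticChar E) ψ with hG
  have hG2 : G ^ 2 = _ := gaussSum_complexQuadraticChar_sq hE hψ
  set δ : ℤ := ∏ i ∈ R, quadraticChar E (w i) with hδ
  have hδ1 : δ = 1 ∨ δ = -1 := by
    rw [hδ]
    apply Finset.prod_induction _ (fun x : ℤ => x = 1 ∨ x = -1)
    · rintro x y (rfl | rfl) (rfl | rfl) <;> simp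
    · simp
    · intro i hi
      exact quadraticChar_dichotomy (Finset.mem_filter.mp hi).2
  have hS : ∀ c : E, c ≠ 0 → ∑ y, ψ (c * traceQuadraticForm σ a b y)
      = (Fintype.card E : ℂ) ^ Z.card * ((quadraticChar E c : ℂ) ^ R.card * δ * G ^ R.card) := by
    intro c hc
    rw [sum_addChar_quadraticForm _ w hw, ← Finset.prod_filter_mul_prod_filter_not Finset.univ
      (fun i => w i = 0)]
    congr 1
    · rw [← Finset.prod_const]
      refine Finset.prod_congr rfl fun i hi => ?_
      simp [(Finset.mem_filter.mp hi).2]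
    · have : ∀ i ∈ R, ∑ x, ψ (c * w i * x ^ 2)
          = (quadraticChar E c : ℂ) * (quadraticChar E (w i) : ℂ) * G := by
        intro i hi
        rw [sum_addChar_mul_sq hE hψ (mul_ne_zero hc (Finset.mem_filter.mp hi).2), map_mul]
        push_cast; rfl
      rw [Finset.prod_congr rfl this, Finset.prod_mul_distrib, Finset.prod_mul_distrib,
        Finset.prod_const, Finset.prod_const, hδ]
      push_cast; rfl
  have hS2 : ∀ c : E, c ≠ 0 → ∑ y, ψ (c * traceQuadraticForm σ a b y)
      + ∑ y, ψ (c * l * traceQuadraticForm σ a b y)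
      = (1 + (-1) ^ R.card) * ((Fintype.card E : ℂ) ^ Z.card *
        ((quadraticChar E c : ℂ) ^ R.card * δ * G ^ R.card)) := by
    intro c hc
    rw [hS c hc, hS (c * l) (mul_ne_zero hc hl0), map_mul, hηl]
    push_cast
    rw [mul_pow]; ring
  rcases Nat.even_or_odd R.card with he | ho
  · have hZ1 : Z.card = 1 := by
      obtain ⟨i, hi⟩ := he
      obtain ⟨j, hj⟩ := hodd
      omega
    obtain ⟨j, hj⟩ := he.two_dvd
    refine ⟨quadraticChar E (-1) ^ j * δ, ?_, fun c hc => ?_⟩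
    · right
      have h1 : quadraticChar E (-1) ^ j = 1 ∨ quadraticChar E (-1) ^ j = -1 := by
        rcases quadraticChar_dichotomy (F := E) (a := -1) (by simp) with h | h <;> rw [h]
        · simp
        · exact neg_one_pow_eq_or ℤ j
      rcases h1 with h | h <;> rcases hδ1 with h' | h' <;> rw [h, h'] <;> simp
    · have hexp : (Module.finrank E K + 1) / 2 = j + 1 := by omega
      have hc1 : (quadraticChar E c : ℂ) ^ 2 = 1 := by exact_mod_cast quadraticChar_sq_one hc
      rw [hS2 c hc, hexp, he.neg_one_pow, hZ1, hj, pow_mul, hc1, pow_mul, hG2]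
      push_cast
      rw [mul_pow]; ring
  · refine ⟨0, Or.inl rfl, fun c hc => ?_⟩
    rw [hS2 c hc, ho.neg_one_pow]; simp

end QuadraticSums

/-- `N = 1 + q + ⋯ + q ^ (κ - 1)` is a sum of an odd number of odd terms. This transfers Euler's
criterion from `GF(q)` to odd powers of `q`. -/
theorem exists_odd_pow_half_eq {q κ : ℕ} (hq : Odd q) (hκ : Odd κ) :
    ∃ N, Odd N ∧ q ^ κ / 2 = q / 2 * N := by
  obtain ⟨h, rfl⟩ := hq
  obtain ⟨j, rfl⟩ := hκ
  suffices ∃ N, Odd N ∧ (2 * h + 1) ^ (2 * j + 1) = 2 * (h * N) + 1 by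
    obtain ⟨N, hN, e⟩ := this
    refine ⟨N, hN, ?_⟩
    rw [e, show (2 * h + 1) / 2 = h by omega]; omega
  induction j with
  | zero => exact ⟨1, odd_one, by simp⟩
  | succ j ih =>
    obtain ⟨N, hN, e⟩ := ih
    refine ⟨N * (2 * h + 1) ^ 2 + (2 * h + 2), ?_, ?_⟩
    · exact (hN.mul (Odd.pow ⟨h, rfl⟩)).add_even ⟨h + 1, by ring⟩
    · rw [show 2 * (j + 1) + 1 = (2 * j + 1) + 2 by ring, pow_add, e]; ring

/-! ### The additive character of a finite field -/

section TraceCharacter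

variable (p : ℕ) [Fact p.Prime] (K : Type*) [Field K] [Algebra (ZMod p) K]

/-- The canonical additive character of a finite field of characteristic `p`. -/
noncomputable def traceChar : AddChar K ℂ :=
  ZMod.stdAddChar.compAddMonoidHom (Algebra.trace (ZMod p) K).toAddMonoidHom

theorem traceChar_apply (x : K) :
    traceChar p K x = ZMod.stdAddChar (Algebra.trace (ZMod p) K x) := rfl

theorem traceChar_isPrimitive [Finite K] : (traceChar p K).IsPrimitive := by
  apply AddChar.IsPrimitive.of_ne_one
  rw [AddChar.ne_one_iff]
  obtain ⟨t, ht⟩ := (AddChar.ne_one_iff (ψ := (ZMod.stdAddChar : AddChar (ZMod p) ℂ))).mp (by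
    have := ZMod.isPrimitive_stdAddChar p (a := 1) one_ne_zero
    rwa [AddChar.mulShift_one] at this)
  obtain ⟨x, rfl⟩ := Algebra.trace_surjective (ZMod p) K t
  exact ⟨x, ht⟩

variable {p K}

theorem traceChar_smul_mul {E : Type*} [Field E] [Finite E] [Finite K] [Algebra (ZMod p) E]
    [Algebra E K] [IsScalarTower (ZMod p) E K] (t : ZMod p) (c : E) (z : K) :
    traceChar p K (t • (algebraMap E K c * z))
      = traceChar p E (algebraMap (ZMod p) E t * c * Algebra.trace E K z) := by
  rw [traceChar_apply, traceChar_apply, ← Algebra.trace_trace (S := E), ← smul_eq_mul (_ * c),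
    ← map_smul]
  congr 3
  rw [Algebra.smul_def, Algebra.smul_def, map_mul, ← IsScalarTower.algebraMap_apply, mul_assoc]

end TraceCharacter

/-! ### The signed half power, and splitting sums over squares and nonsquares -/

section HalfPower

variable {K : Type*} [Field K] [Fintype K] [DecidableEq K]

/-- `x ↦ η(x) x ^ ((P + 1) / 2)`, with `η` the quadratic character. -/
noncomputable def signedHalfPower (P : ℕ) (x : K) : K :=
  ((quadraticChar K x : ℤ) : K) * x ^ ((P + 1) / 2)

theorem signedHalfPower_sq {P : ℕ} (hP : Odd P) (y : K) :
    signedHalfPower P (y ^ 2) = y * y ^ P := by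
  obtain ⟨j, rfl⟩ := hP
  by_cases hy : y = 0
  · subst hy; simp [signedHalfPower]
  · rw [signedHalfPower, quadraticChar_sq_one' hy, ← pow_mul,
      show 2 * ((2 * j + 1 + 1) / 2) = 2 * j + 1 + 1 by omega]
    push_cast; ring

/-- Two signs cancel, `η(l) = -1` and `l ^ ((P + 1) / 2) = -l`; so `y²` and `l y²` lead to multiples
of one quadratic form. -/
theorem signedHalfPower_mul_sq {P : ℕ} (hP : Odd P) {l : K} (hl : quadraticChar K l = -1)
    (hlP : l ^ (P / 2) = -1) (y : K) :
    signedHalfPower P (l * y ^ 2) = l * (y * y ^ P) := by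
  have := signedHalfPower_sq hP y
  rw [signedHalfPower] at this ⊢
  rw [map_mul, hl, mul_pow, ← this]
  have h2 : l ^ ((P + 1) / 2) = - l := by
    obtain ⟨j, rfl⟩ := hP
    rw [show (2 * j + 1 + 1) / 2 = (2 * j + 1) / 2 + 1 by omega, pow_succ, hlP]; ring
  rw [h2]; push_cast; ring

/-- Each nonzero `x` is hit twice, by exactly one of `y²` and `l y²`; zero is hit once by each. -/
theorem sum_sq_add_sum_mul_sq (hK : ringChar K ≠ 2) {l : K} (hl : quadraticChar K l = -1)
    (F : K → ℂ) : ∑ y, F (y ^ 2) + ∑ y, F (l * y ^ 2) = 2 * ∑ x, F x := by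
  have hl0 : l ≠ 0 := by rintro rfl; simp at hl
  rw [sum_sq_eq_sum_quadraticChar hK F, sum_sq_eq_sum_quadraticChar hK (fun z => F (l * z))]
  have : ∑ z, (1 + (quadraticChar K z : ℂ)) * F (l * z)
      = ∑ x, (1 - (quadraticChar K x : ℂ)) * F x := by
    rw [← Equiv.sum_comp (Equiv.mulLeft₀ l hl0) (fun x => (1 - (quadraticChar K x : ℂ)) * F x)]
    refine Finset.sum_congr rfl fun z _ => ?_
    simp only [Equiv.mulLeft₀_apply, map_mul, hl]
    push_cast; ring
  rw [this, ← Finset.sum_add_distrib, Finset.mul_sum]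
  refine Finset.sum_congr rfl fun z _ => ?_
  ring

end HalfPower

/-! ### Values and moments of the Walsh sums -/

section Walsh

variable {p : ℕ} [Fact p.Prime] {K : Type*} [Field K] [Fintype K] [DecidableEq K]
  [Algebra (ZMod p) K]

/-- The exponential sum `∑ x, ψ (t (a x + b θ(x)))` with `θ = signedHalfPower P`. -/
noncomputable def walshSum (p : ℕ) [Fact p.Prime] [Algebra (ZMod p) K] (P : ℕ) (v : K × K)
    (t : ZMod p) : ℂ :=
  ∑ x, traceChar p K (t • (v.1 * x + v.2 * signedHalfPower P x))

/-- Both `κ` and `[K : E]` are periods of `x` under Frobenius, hence so is their gcd, which is one.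
-/
theorem mem_range_algebraMap_of_pow_card_pow_eq {E : Type*} [Field E] [Fintype E] [Algebra E K]
    {κ : ℕ} (hκ : (Module.finrank E K).Coprime κ) {x : K} (hx : x ^ (Fintype.card E ^ κ) = x) :
    x ∈ Set.range (algebraMap E K) := by
  set f := FiniteField.frobeniusAlgEquivOfAlgebraic E K with hf
  have h1 : Function.IsPeriodicPt f κ x := by
    rw [Function.IsPeriodicPt, hf, FiniteField.coe_frobeniusAlgEquivOfAlgebraic_iterate]
    exact hx
  have h2 : Function.IsPeriodicPt f (Module.finrank E K) x := by
    rw [Function.IsPeriodicPt, hf, FiniteField.coe_frobeniusAlgEquivOfAlgebraic_iterate]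
    change x ^ _ = x
    rw [← Module.card_eq_pow_finrank (K := E) (V := K), FiniteField.pow_card]
  have h3 := h2.gcd h1
  rw [hκ] at h3
  have h4 : f x = x := h3
  rw [IsGalois.mem_range_algebraMap_iff_fixed]
  intro g
  obtain ⟨n, rfl⟩ := (FiniteField.bijective_frobeniusAlgEquivOfAlgebraic_pow E K).2 g
  have h5 : Function.IsPeriodicPt f n x := by simpa using h3.const_mul (n : ℕ)
  rw [AlgEquiv.coe_pow]
  exact h5

theorem walshSum_eq_of_tower {E : Type*} [Field E] [Fintype E] [Algebra (ZMod p) E] [Algebra E K]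
    [IsScalarTower (ZMod p) E K] (hE : ringChar E ≠ 2) (hodd : Odd (Module.finrank E K))
    {κ : ℕ} (hκodd : Odd κ) (hκ : (Module.finrank E K).Coprime κ) {v : K × K} (hv : v ≠ 0) :
    ∃ ε : ℤ, (ε = 0 ∨ ε = 1 ∨ ε = -1) ∧ ∀ t : ZMod p, t ≠ 0 →
      walshSum p (Fintype.card E ^ κ) v t
        = ε * (Fintype.card E : ℂ) ^ ((Module.finrank E K + 1) / 2) := by
  classical
  obtain ⟨a, b⟩ := v
  have hEodd : Odd (Fintype.card E) := Nat.odd_iff.mpr (FiniteField.odd_card_of_char_ne_two hE)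
  have hPodd : Odd (Fintype.card E ^ κ) := hEodd.pow
  have hKE : ringChar K ≠ 2 := by rwa [← Algebra.ringChar_eq E K]
  obtain ⟨l, hl⟩ := FiniteField.exists_nonsquare hE
  have hηl : quadraticChar E l = -1 := quadraticChar_neg_one_iff_not_isSquare.mpr hl
  -- Used for `j = [K : E]`, where it makes `l` a nonsquare of `K`, and for `j = κ`, where it
  -- evaluates the half power at `l`.
  have hhalf : ∀ j, Odd j → (algebraMap E K l) ^ (Fintype.card E ^ j / 2) = -1 := by
    intro j hj
    obtain ⟨N, hN, e⟩ := exists_odd_pow_half_eq hEodd hj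
    have h := quadraticChar_eq_pow_of_char_ne_two' hE l
    rw [e, pow_mul, ← map_pow, ← h, hηl]
    simp [hN.neg_one_pow]
  have hηlK : quadraticChar K (algebraMap E K l) = -1 := by
    have hl0 : algebraMap E K l ≠ 0 := by
      intro h
      rw [map_eq_zero] at h
      exact hl (h ▸ IsSquare.zero)
    rw [quadraticChar_eq_pow_of_char_ne_two hKE hl0, Module.card_eq_pow_finrank (K := E) (V := K),
      hhalf _ hodd, if_neg (Ring.neg_one_ne_one_of_char_ne_two hKE)]
  set σ : K ≃ₐ[E] K := FiniteField.frobeniusAlgEquivOfAlgebraic E K ^ κ with hσ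
  have hσa : ∀ x, σ x = x ^ (Fintype.card E ^ κ) := by
    intro x
    rw [hσ, AlgEquiv.coe_pow, FiniteField.coe_frobeniusAlgEquivOfAlgebraic_iterate]
  obtain ⟨ε, hε, h⟩ := sum_add_sum_addChar_traceQuadraticForm hE hodd σ
    (fun x hx => mem_range_algebraMap_of_pow_card_pow_eq hκ (by rwa [hσa] at hx))
    (a := a) (b := b) hv (traceChar_isPrimitive p E) hl
  refine ⟨ε, hε, fun t ht => ?_⟩
  have ht' : algebraMap (ZMod p) E t ≠ 0 := by simpa using ht
  have h1 := h _ ht'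
  have h2 := sum_sq_add_sum_mul_sq hKE hηlK (fun x => traceChar p K
    (t • (a * x + b * signedHalfPower (Fintype.card E ^ κ) x)))
  have e1 : ∀ y : K, traceChar p K (t • (a * y ^ 2 + b * signedHalfPower (Fintype.card E ^ κ)
      (y ^ 2))) = traceChar p E (algebraMap (ZMod p) E t * traceQuadraticForm σ a b y) := by
    intro y
    have := traceChar_smul_mul (E := E) t 1 (a * y ^ 2 + b * (y * σ y))
    rw [map_one, one_mul, mul_one] at this
    rw [traceQuadraticForm_apply, ← this, signedHalfPower_sq hPodd, hσa]
  have e2 : ∀ y : K, traceChar p K (t • (a * (algebraMap E K l * y ^ 2) +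
      b * signedHalfPower (Fintype.card E ^ κ) (algebraMap E K l * y ^ 2)))
      = traceChar p E (algebraMap (ZMod p) E t * l * traceQuadraticForm σ a b y) := by
    intro y
    rw [traceQuadraticForm_apply, ← traceChar_smul_mul (E := E) t l,
      signedHalfPower_mul_sq hPodd hηlK (hhalf _ hκodd), hσa]
    congr 2; ring
  simp only [e1, e2] at h2
  rw [h1] at h2
  have := mul_left_cancel₀ (two_ne_zero (α := ℂ)) ((mul_assoc _ _ _).symm.trans h2)
  exact this.symm

/-- The tower result for `E = GF(p ^ e)`, `e = gcd(m, k)`, `κ = k / e`: here `|E| ^ κ = p ^ k` and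
`e (s + 1) / 2 = (m + e) / 2`. -/
theorem walshSum_eq {m k : ℕ} (hp : Odd p) (hm : 0 < m)
    (hsodd : Odd (m / m.gcd k)) (hke : Odd (k / m.gcd k)) (hK : Fintype.card K = p ^ m)
    {v : K × K} (hv : v ≠ 0) :
    ∃ ε : ℤ, (ε = 0 ∨ ε = 1 ∨ ε = -1) ∧ ∀ t : ZMod p, t ≠ 0 →
      walshSum p (p ^ k) v t = ε * (p : ℂ) ^ ((m + m.gcd k) / 2) := by
  have hpp : p.Prime := Fact.out
  have he0 : 0 < m.gcd k := Nat.gcd_pos_of_pos_left _ hm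
  have hfK : Module.finrank (ZMod p) K = m := by
    have := FiniteField.pow_finrank_eq_card p K
    exact Nat.pow_right_injective hpp.two_le (this.trans hK)
  have : Fintype (GaloisField p (m.gcd k)) := Fintype.ofFinite _
  have hcE : Fintype.card (GaloisField p (m.gcd k)) = p ^ (m.gcd k) := by
    rw [← Nat.card_eq_fintype_card, GaloisField.card p _ he0.ne']
  have hfE : Module.finrank (ZMod p) (GaloisField p (m.gcd k)) = m.gcd k :=
    GaloisField.finrank p he0.ne'
  obtain ⟨i⟩ : Nonempty (GaloisField p (m.gcd k) →ₐ[ZMod p] K) :=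
    FiniteField.nonempty_algHom_of_finrank_dvd (by rw [hfK, hfE]; exact Nat.gcd_dvd_left m k)
  let _ : Algebra (GaloisField p (m.gcd k)) K := i.toRingHom.toAlgebra
  have : IsScalarTower (ZMod p) (GaloisField p (m.gcd k)) K :=
    IsScalarTower.of_algebraMap_eq fun x => (i.commutes x).symm
  have hchar : ringChar (GaloisField p (m.gcd k)) ≠ 2 := by
    rw [← Algebra.ringChar_eq (ZMod p), ZMod.ringChar_zmod_n]
    rintro rfl
    exact absurd hp (by decide)
  have hfin : Module.finrank (GaloisField p (m.gcd k)) K = m / m.gcd k := by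
    have := Module.finrank_mul_finrank (ZMod p) (GaloisField p (m.gcd k)) K
    rw [hfE, hfK] at this
    exact (Nat.div_eq_of_eq_mul_right he0 this.symm).symm
  obtain ⟨ε, hε, h⟩ := walshSum_eq_of_tower (p := p) (K := K) (E := GaloisField p (m.gcd k)) hchar
    (by rwa [hfin]) hke (by rw [hfin]; exact Nat.coprime_div_gcd_div_gcd he0) hv
  refine ⟨ε, hε, fun t ht => ?_⟩
  have h1 := h t ht
  rw [hfin, hcE, ← pow_mul, Nat.mul_div_cancel' (Nat.gcd_dvd_right m k)] at h1
  rw [h1]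
  push_cast
  rw [← pow_mul]
  congr 2
  have hm' : m = m.gcd k * (m / m.gcd k) := (Nat.mul_div_cancel' (Nat.gcd_dvd_left m k)).symm
  obtain ⟨j, hj⟩ := hsodd
  rw [hj] at hm' ⊢
  have e1 : m + m.gcd k = 2 * (m.gcd k * (j + 1)) := by
    conv_lhs => rw [hm']
    have : m.gcd k * (2 * j + 1) + m.gcd k = 2 * (m.gcd k * (j + 1)) := by ring
    rw [← hm'] at this ⊢
    exact this
  rw [e1, show (2 * j + 1 + 1) / 2 = j + 1 by omega]; omega

theorem sum_prod_traceChar (t : ZMod p) (ht : t ≠ 0) (x y : K) :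
    ∑ v : K × K, traceChar p K (t • (v.1 * x + v.2 * y))
      = if x = 0 ∧ y = 0 then (Fintype.card K : ℂ) ^ 2 else 0 := by
  have ht' : algebraMap (ZMod p) K t ≠ 0 := by simpa using ht
  have h : ∀ z : K, ∑ c, traceChar p K (t • (c * z)) = if z = 0 then (Fintype.card K : ℂ) else 0 := by
    intro z
    have := AddChar.sum_mulShift (algebraMap (ZMod p) K t * z) (traceChar_isPrimitive p K)
    simp only [mul_eq_zero, ht', false_or, Nat.cast_ite, Nat.cast_zero] at this
    rw [← this]
    refine Finset.sum_congr rfl fun c _ => ?_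
    congr 1
    rw [Algebra.smul_def]; ring
  rw [Fintype.sum_prod_type]
  simp only [smul_add, AddChar.map_add_eq_mul, ← Finset.mul_sum, ← Finset.sum_mul, h]
  split_ifs <;> simp_all [pow_two]

theorem sum_walshSum {P : ℕ} (t : ZMod p) (ht : t ≠ 0) :
    ∑ v : K × K, walshSum p P v t = (Fintype.card K : ℂ) ^ 2 := by
  simp only [walshSum]
  rw [Finset.sum_comm]
  simp only [sum_prod_traceChar t ht]
  rw [Finset.sum_eq_single 0]
  · simp [signedHalfPower]
  · intro x _ hx; simp [hx]
  · simp

/-- Only pairs `x = y` survive orthogonality; the coefficient `x - y` alone forces this, so nothing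
about `θ` is needed. -/
theorem sum_walshSum_mul_conj (P : ℕ) (t : ZMod p) (ht : t ≠ 0) :
    ∑ v : K × K, walshSum p P v t * (starRingEnd ℂ) (walshSum p P v t)
      = (Fintype.card K : ℂ) ^ 3 := by
  have h : ∀ v : K × K, walshSum p P v t * (starRingEnd ℂ) (walshSum p P v t)
      = ∑ x, ∑ y, traceChar p K (t • (v.1 * (x - y)
        + v.2 * (signedHalfPower P x - signedHalfPower P y))) := by
    intro v
    rw [walshSum, map_sum, Finset.sum_mul_sum]
    refine Finset.sum_congr rfl fun x _ => Finset.sum_congr rfl fun y _ => ?_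
    rw [← AddChar.map_neg_eq_conj, ← AddChar.map_add_eq_mul]
    congr 1
    rw [← smul_neg, ← smul_add]
    congr 1; ring
  simp only [h]
  rw [Finset.sum_comm]
  have h2 : ∀ x : K, ∑ v : K × K, ∑ y, traceChar p K (t • (v.1 * (x - y)
        + v.2 * (signedHalfPower P x - signedHalfPower P y))) = (Fintype.card K : ℂ) ^ 2 := by
    intro x
    rw [Finset.sum_comm]
    simp only [sum_prod_traceChar t ht]
    rw [Finset.sum_eq_single x]
    · simp
    · intro y _ hy; simp [sub_eq_zero, hy.symm]
    · simp
  simp only [h2, Finset.sum_const, Finset.card_univ, nsmul_eq_mul]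
  ring

/-- Summing over all `t` detects trace zero; the term `t = 0` contributes `|K|`. -/
theorem mul_card_trace_eq_zero (P : ℕ) (v : K × K) :
    (p : ℂ) * (Finset.univ.filter fun x : K => Algebra.trace (ZMod p) K
      (v.1 * x + v.2 * signedHalfPower P x) = 0).card
      = Fintype.card K + ∑ t ∈ Finset.univ.erase (0 : ZMod p), walshSum p P v t := by
  have h0 : walshSum p P v 0 = Fintype.card K := by simp [walshSum]
  rw [← h0, Finset.add_sum_erase _ _ (Finset.mem_univ 0)]
  simp only [walshSum]
  rw [Finset.sum_comm, Finset.card_filter]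
  push_cast
  rw [Finset.mul_sum]
  refine Finset.sum_congr rfl fun x _ => ?_
  have := AddChar.sum_mulShift (Algebra.trace (ZMod p) K (v.1 * x + v.2 * signedHalfPower P x))
    (ZMod.isPrimitive_stdAddChar p)
  simp only [traceChar_apply, map_smul, smul_eq_mul, this, ZMod.card]
  split_ifs <;> simp

end Walsh

/-! ### Cyclic codes given by a parity-check polynomial -/

section CyclicCodes

variable {F : Type*} [Field F] {n : ℕ}

theorem codewordClass_apply (c : Fin n → F) :
    codewordClass F n c
      = Ideal.Quotient.mk (Ideal.span {(X ^ n - 1 : F[X])}) (∑ i : Fin n, monomial (i : ℕ) (c i)) := by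
  simp [codewordClass, Ideal.Quotient.mkₐ]

theorem codewordClass_injective : Function.Injective (codewordClass F n) := by
  rw [← LinearMap.ker_eq_bot, LinearMap.ker_eq_bot']
  intro c hc
  rw [codewordClass_apply, Ideal.Quotient.eq_zero_iff_mem, Ideal.mem_span_singleton] at hc
  have hcoeff : ∀ j : ℕ, (∑ i : Fin n, monomial (i : ℕ) (c i)).coeff j
      = ∑ i : Fin n, if (i : ℕ) = j then c i else 0 := by
    intro j; simp [coeff_monomial]
  by_cases hn : n = 0
  · subst hn; exact Subsingleton.elim _ _
  have hdeg : (∑ i : Fin n, monomial (i : ℕ) (c i)).degree < (X ^ n - 1 : F[X]).degree := by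
    have hd : (X ^ n - 1 : F[X]).degree = n := by
      simpa using degree_X_pow_sub_C (Nat.pos_of_ne_zero hn) (1 : F)
    rw [hd, degree_lt_iff_coeff_zero]
    intro j hj
    rw [hcoeff]
    exact Finset.sum_eq_zero fun i _ => if_neg (by have := i.2; omega)
  have h0 := eq_zero_of_dvd_of_degree_lt hc hdeg
  ext i
  have := hcoeff i
  rw [h0] at this
  simpa [Fin.val_inj] using this.symm

theorem codewordClass_rotate (c : Fin n → F) :
    codewordClass F n (fun i => c ((finRotate n).symm i))
      = Ideal.Quotient.mk (Ideal.span {(X ^ n - 1 : F[X])}) X * codewordClass F n c := by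
  rw [codewordClass_apply, codewordClass_apply, ← map_mul, Finset.mul_sum, map_sum, map_sum,
    ← Equiv.sum_comp (finRotate n)]
  refine Finset.sum_congr rfl fun i _ => ?_
  rw [Equiv.symm_apply_apply]
  obtain _ | n := n
  · exact i.elim0
  rw [Ideal.Quotient.mk_eq_mk_iff_sub_mem, Ideal.mem_span_singleton, finRotate_apply,
    Fin.val_add_one]
  split_ifs with hi
  -- The coefficient that wraps around: `c - c X ^ n = -c (X ^ n - 1)`.
  · refine ⟨- C (c i), ?_⟩
    rw [hi, ← C_mul_X_pow_eq_monomial, ← C_mul_X_pow_eq_monomial, Fin.val_last]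
    ring
  · refine ⟨0, ?_⟩
    rw [← C_mul_X_pow_eq_monomial, ← C_mul_X_pow_eq_monomial]
    ring

theorem isCyclicCode_cyclicCodeOfParityCheck (h : F[X]) :
    IsCyclicCode (cyclicCodeOfParityCheck F n h) := by
  intro c hc
  change codewordClass F n _ ∈ Ideal.span _
  rw [codewordClass_rotate]
  exact Ideal.mul_mem_left _ _ hc

theorem mem_cyclicCodeOfParityCheck {h : F[X]} (hh : h ∣ X ^ n - 1) (h0 : h ≠ 0) {c : Fin n → F}
    (hc : Ideal.Quotient.mk (Ideal.span {(X ^ n - 1 : F[X])}) h * codewordClass F n c = 0) :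
    c ∈ cyclicCodeOfParityCheck F n h := by
  change codewordClass F n c ∈ Ideal.span _
  obtain ⟨g, hg⟩ := hh
  have hdiv : (X ^ n - 1 : F[X]) / h = g := by rw [hg, mul_div_cancel_left₀ _ h0]
  rw [codewordClass_apply] at hc ⊢
  rw [← map_mul, Ideal.Quotient.eq_zero_iff_mem, Ideal.mem_span_singleton] at hc
  rw [hdiv, Ideal.mem_span_singleton]
  apply _root_.map_dvd
  have : h * g ∣ h * ∑ i : Fin n, monomial (i : ℕ) (c i) := hg ▸ hc
  exact (mul_dvd_mul_iff_left h0).mp this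

/-- A codeword is the class of `g f` with `h g = X ^ n - 1`, so only `f` modulo `h` matters. -/
theorem finrank_cyclicCodeOfParityCheck_le {h : F[X]} (hh : h ∣ X ^ n - 1) (h0 : h ≠ 0) :
    Module.finrank F (cyclicCodeOfParityCheck F n h) ≤ h.natDegree := by
  obtain ⟨g, hg⟩ := hh
  have hdiv : (X ^ n - 1 : F[X]) / h = g := by rw [hg, mul_div_cancel_left₀ _ h0]
  let I := Ideal.span {(X ^ n - 1 : F[X])}
  let φ : degreeLT F h.natDegree →ₗ[F] F[X] ⧸ I :=
    (Ideal.Quotient.mkₐ F I).toLinearMap ∘ₗ LinearMap.mulLeft F g ∘ₗ (degreeLT F h.natDegree).subtype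
  have hle : (cyclicCodeOfParityCheck F n h).map (codewordClass F n) ≤ φ.range := by
    rw [Submodule.map_le_iff_le_comap]
    intro c hc
    have hc' : codewordClass F n c ∈ Ideal.span {Ideal.Quotient.mk I ((X ^ n - 1) / h)} := hc
    rw [hdiv, Ideal.mem_span_singleton] at hc'
    obtain ⟨u, hu⟩ := hc'
    obtain ⟨f, rfl⟩ := Ideal.Quotient.mk_surjective u
    refine ⟨⟨f % h, ?_⟩, ?_⟩
    · rw [mem_degreeLT, ← degree_eq_natDegree h0]
      exact EuclideanDomain.mod_lt f h0
    · rw [hu, ← map_mul]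
      change Ideal.Quotient.mk I (g * (f % h)) = _
      rw [Ideal.Quotient.mk_eq_mk_iff_sub_mem, Ideal.mem_span_singleton, hg]
      refine ⟨-(f / h), ?_⟩
      linear_combination g * EuclideanDomain.mod_add_div f h
  have hfin : Module.Finite F (degreeLT F h.natDegree) :=
    Module.Finite.equiv (degreeLTEquiv F h.natDegree).symm
  calc Module.finrank F (cyclicCodeOfParityCheck F n h)
      = Module.finrank F ((cyclicCodeOfParityCheck F n h).map (codewordClass F n)) :=
        (Submodule.equivMapOfInjective _ codewordClass_injective _).finrank_eq
    _ ≤ Module.finrank F φ.range := Submodule.finrank_mono hle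
    _ ≤ Module.finrank F (degreeLT F h.natDegree) := φ.finrank_range_le
    _ = h.natDegree := by
        rw [(degreeLTEquiv F h.natDegree).finrank_eq, Module.finrank_fin_fun]

end CyclicCodes

/-! ### Trace description of the code -/

section TraceWords

variable {F K : Type*} [Field F] [Field K] [Algebra F K]

/-- The linear map `a ↦ (Tr (a α ^ i))_i`. -/
noncomputable def traceWord (F : Type*) [Field F] [Algebra F K] (n : ℕ) (α : K) :
    K →ₗ[F] (Fin n → F) :=
  LinearMap.pi fun i => Algebra.trace F K ∘ₗ LinearMap.mulRight F (α ^ (i : ℕ))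

theorem traceWord_apply (n : ℕ) (α a : K) (i : Fin n) :
    traceWord F n α a i = Algebra.trace F K (a * α ^ (i : ℕ)) := rfl

/-- Multiplication by `X` is the cyclic shift, which replaces `a` by `α⁻¹ a`. Consequently the
minimal polynomial of `α⁻¹` annihilates these words. -/
theorem mk_mul_codewordClass_traceWord {n : ℕ} {α : K} (hα : α ^ n = 1) (hn : n ≠ 0) (f : F[X]) (a : K) :
    Ideal.Quotient.mk (Ideal.span {(X ^ n - 1 : F[X])}) f * codewordClass F n (traceWord F n α a)
      = codewordClass F n (traceWord F n α (aeval α⁻¹ f * a)) := by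
  have hα0 : α ≠ 0 := by
    rintro rfl
    rw [zero_pow hn] at hα
    exact zero_ne_one hα
  have hX : ∀ a, Ideal.Quotient.mk (Ideal.span {(X ^ n - 1 : F[X])}) X
      * codewordClass F n (traceWord F n α a) = codewordClass F n (traceWord F n α (α⁻¹ * a)) := by
    intro a
    rw [← codewordClass_rotate]
    congr 1
    ext i
    obtain ⟨j, rfl⟩ := (finRotate n).surjective i
    rw [Equiv.symm_apply_apply, traceWord_apply, traceWord_apply]
    congr 1
    have : α ^ ((finRotate n j : Fin n) : ℕ) = α * α ^ (j : ℕ) := by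
      obtain _ | n := n
      · exact j.elim0
      rw [finRotate_apply, Fin.val_add_one]
      split_ifs with hj
      · rw [hj, Fin.val_last, ← pow_succ', hα, pow_zero]
      · rw [pow_succ']
    rw [this]; field_simp
  induction f using Polynomial.induction_on' generalizing a with
  | add f g hf hg => rw [map_add, add_mul, hf, hg, map_add, add_mul, map_add, map_add]
  | monomial j c =>
    induction j generalizing a with
    | zero =>
      rw [monomial_zero_left, aeval_C, ← Algebra.smul_def, map_smul, map_smul,
        Algebra.smul_def c (codewordClass F n _)]
      rfl
    | succ j ih =>
      rw [← monomial_mul_X, map_mul, mul_assoc, hX, ih, map_mul (aeval _), aeval_X, mul_assoc]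

theorem minpoly_dvd_X_pow_sub_one {n : ℕ} {α : K} (hα : α ^ n = 1) :
    minpoly F α ∣ X ^ n - 1 := minpoly.dvd F α (by simp [hα])

/-- Conjugate elements have powers of equal trace. Injectivity of the trace words therefore makes
the two minimal polynomials distinct. -/
theorem exists_traceWord_add_eq_zero_of_minpoly_eq [Normal F K] (n : ℕ) {α β : K}
    (h : minpoly F α⁻¹ = minpoly F β⁻¹) :
    ∃ v : K × K, v ≠ 0 ∧ traceWord F n α v.1 + traceWord F n β v.2 = 0 := by
  obtain ⟨g, hg⟩ := (Normal.minpoly_eq_iff_mem_orbit K).mp h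
  have hg' : g β = α := by
    have : g β⁻¹ = α⁻¹ := hg
    rw [map_inv₀] at this
    exact inv_injective this
  refine ⟨(1, -1), by simp, ?_⟩
  ext i
  rw [Pi.add_apply, traceWord_apply, traceWord_apply, ← hg',
    ← Algebra.trace_eq_of_algEquiv g (-1 * β ^ (i : ℕ))]
  simp

/-- The cyclic code whose parity-check polynomial is the product of the minimal polynomials of
`α⁻¹` and `β⁻¹` consists of the trace words, provided that these are pairwise different. -/
theorem cyclicCodeOfParityCheck_minpoly_mul_minpoly [FiniteDimensional F K] [Normal F K] {n : ℕ}
    (hn : n ≠ 0) {α β : K} (hα : α ^ n = 1) (hβ : β ^ n = 1)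
    (hinj : Function.Injective ((traceWord F n α).coprod (traceWord F n β))) :
    minpoly F α⁻¹ * minpoly F β⁻¹ ∣ X ^ n - 1 ∧
    cyclicCodeOfParityCheck F n (minpoly F α⁻¹ * minpoly F β⁻¹)
      = ((traceWord F n α).coprod (traceWord F n β)).range := by
  have hiα : IsIntegral F α⁻¹ := Algebra.IsIntegral.isIntegral _
  have hiβ : IsIntegral F β⁻¹ := Algebra.IsIntegral.isIntegral _
  have hne : minpoly F α⁻¹ ≠ minpoly F β⁻¹ := by
    intro h
    obtain ⟨v, hv, h0⟩ := exists_traceWord_add_eq_zero_of_minpoly_eq n h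
    exact hv (hinj (by rw [map_zero]; simpa using h0))
  have hcop : IsCoprime (minpoly F α⁻¹) (minpoly F β⁻¹) := by
    refine (minpoly.irreducible hiα).coprime_iff_not_dvd.mpr fun hd => hne ?_
    exact eq_of_monic_of_associated (minpoly.monic hiα) (minpoly.monic hiβ)
      ((minpoly.irreducible hiα).associated_of_dvd (minpoly.irreducible hiβ) hd)
  have hdvd : minpoly F α⁻¹ * minpoly F β⁻¹ ∣ X ^ n - 1 :=
    hcop.mul_dvd (minpoly_dvd_X_pow_sub_one (by rw [inv_pow, hα, inv_one]))
      (minpoly_dvd_X_pow_sub_one (by rw [inv_pow, hβ, inv_one]))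
  have h0 : minpoly F α⁻¹ * minpoly F β⁻¹ ≠ 0 :=
    mul_ne_zero (minpoly.ne_zero hiα) (minpoly.ne_zero hiβ)
  -- The trace words lie in the code and have dimension `2 [K : F]`, a bound for the degree of the
  -- parity-check polynomial and so for the dimension of the code.
  refine ⟨hdvd, (Submodule.eq_of_le_of_finrank_le ?_ ?_).symm⟩
  · rintro _ ⟨v, rfl⟩
    apply mem_cyclicCodeOfParityCheck hdvd h0
    rw [LinearMap.coprod_apply, map_add, mul_add, mk_mul_codewordClass_traceWord hα hn,
      mk_mul_codewordClass_traceWord hβ hn, map_mul (aeval _), map_mul (aeval _), minpoly.aeval, minpoly.aeval]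
    simp
  · refine (finrank_cyclicCodeOfParityCheck_le hdvd h0).trans ?_
    rw [LinearMap.finrank_range_of_inj hinj, Module.finrank_prod,
      natDegree_mul (minpoly.ne_zero hiα) (minpoly.ne_zero hiβ)]
    exact add_le_add (minpoly.natDegree_le _) (minpoly.natDegree_le _)

end TraceWords

/-! ### Weights of the words in terms of Walsh sums -/

section Weights

variable {p : ℕ} [Fact p.Prime] {K : Type*} [Field K] [Algebra (ZMod p) K]

/-- The word `(Tr (a (-π) ^ i + b π ^ (i (p ^ k + 1) / 2)))_i` attached to `(a, b)`. -/
noncomputable def zhouDingWord (p m k : ℕ) [Fact p.Prime] [Algebra (ZMod p) K] (π : K) :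
    K × K →ₗ[ZMod p] (Fin (p ^ m - 1) → ZMod p) :=
  (traceWord (ZMod p) (p ^ m - 1) (-π)).coprod
    (traceWord (ZMod p) (p ^ m - 1) (π ^ ((p ^ k + 1) / 2)))

variable [Fintype K] [DecidableEq K]

theorem quadraticChar_pow_of_isPrimitiveRoot (hK : ringChar K ≠ 2) {π : K}
    (hπ : IsPrimitiveRoot π (Fintype.card K - 1)) (i : ℕ) :
    quadraticChar K (π ^ i) = (-1) ^ i := by
  have hodd := FiniteField.odd_card_of_char_ne_two hK
  have h1 : 1 < Fintype.card K := Fintype.one_lt_card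
  have hπ0 : π ≠ 0 := hπ.ne_zero (by omega)
  rw [map_pow]
  congr 1
  rw [quadraticChar_eq_pow_of_char_ne_two hK hπ0, if_neg]
  exact hπ.pow_ne_one_of_pos_of_lt (by omega) (by omega)

/-- The coordinate is `(-1) ^ i` times the trace on the right, because `(-1) ^ i = η(π ^ i)`. -/
theorem zhouDingWord_apply_eq_zero_iff {m k : ℕ} (hp : Odd p) (hK : Fintype.card K = p ^ m)
    {π : K} (hπ : IsPrimitiveRoot π (p ^ m - 1)) (v : K × K) (i : Fin (p ^ m - 1)) :
    zhouDingWord p m k π v i = 0 ↔ Algebra.trace (ZMod p) K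
      (v.1 * π ^ (i : ℕ) + v.2 * signedHalfPower (p ^ k) (π ^ (i : ℕ))) = 0 := by
  have hchar : ringChar K ≠ 2 := by
    rw [← Algebra.ringChar_eq (ZMod p), ZMod.ringChar_zmod_n]
    rintro rfl
    exact absurd hp (by decide)
  have h1 : zhouDingWord p m k π v i = Algebra.trace (ZMod p) K
      (v.1 * (-π) ^ (i : ℕ) + v.2 * (π ^ ((p ^ k + 1) / 2)) ^ (i : ℕ)) := by
    simp [zhouDingWord, traceWord_apply]
  rw [h1, signedHalfPower, quadraticChar_pow_of_isPrimitiveRoot hchar (hK ▸ hπ), neg_pow,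
    ← pow_mul, ← pow_mul, mul_comm ((p ^ k + 1) / 2)]
  rcases neg_one_pow_eq_or ℤ (i : ℕ) with h | h
  · have h' : (-1 : K) ^ (i : ℕ) = 1 := by exact_mod_cast congrArg (Int.cast : ℤ → K) h
    rw [h, h']; simp
  · have h' : (-1 : K) ^ (i : ℕ) = -1 := by
      have := congrArg (Int.cast : ℤ → K) h
      push_cast at this; exact this
    rw [h, h', ← neg_eq_zero, ← map_neg]
    apply iff_of_eq; congr 2
    push_cast; ring

/-- The powers of `π` exhaust the nonzero elements; `x = 0`, always a zero, raises the total from `p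
^ m - 1` to `p ^ m`. -/
theorem hammingNorm_zhouDingWord_add_card {m k : ℕ} (hp : Odd p) (hK : Fintype.card K = p ^ m)
    {π : K} (hπ : IsPrimitiveRoot π (p ^ m - 1)) (v : K × K) :
    hammingNorm (zhouDingWord p m k π v) + (Finset.univ.filter fun x : K =>
      Algebra.trace (ZMod p) K (v.1 * x + v.2 * signedHalfPower (p ^ k) x) = 0).card = p ^ m := by
  have h1 : 1 < Fintype.card K := Fintype.one_lt_card
  have hπ0 : π ≠ 0 := hπ.ne_zero (by omega)
  set S := Finset.univ.filter fun x : K =>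
      Algebra.trace (ZMod p) K (v.1 * x + v.2 * signedHalfPower (p ^ k) x) = 0 with hS
  have h0 : (0 : K) ∈ S := by simp [hS, signedHalfPower]
  set Z := Finset.univ.filter fun i => zhouDingWord p m k π v i = 0 with hZ
  have hcard : Z.card = (S.erase 0).card := by
    refine Finset.card_bij (fun i _ => π ^ (i : ℕ)) ?_ ?_ ?_
    · intro i hi
      rw [hZ, Finset.mem_filter, zhouDingWord_apply_eq_zero_iff hp hK hπ] at hi
      rw [Finset.mem_erase, hS, Finset.mem_filter]
      exact ⟨pow_ne_zero _ hπ0, Finset.mem_univ _, hi.2⟩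
    · intro i _ j _ hij
      exact Fin.ext (hπ.pow_inj i.2 j.2 hij)
    · intro x hx
      rw [Finset.mem_erase, hS, Finset.mem_filter] at hx
      have hx1 : x ^ (p ^ m - 1) = 1 := by rw [← hK]; exact FiniteField.pow_card_sub_one_eq_one x hx.1
      have : NeZero (p ^ m - 1) := ⟨by omega⟩
      obtain ⟨i, hi, rfl⟩ := hπ.eq_pow_of_pow_eq_one hx1
      refine ⟨⟨i, hi⟩, ?_, rfl⟩
      rw [hZ, Finset.mem_filter, zhouDingWord_apply_eq_zero_iff hp hK hπ]
      exact ⟨Finset.mem_univ _, hx.2.2⟩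
  have hsplit : Z.card + hammingNorm (zhouDingWord p m k π v) = p ^ m - 1 := by
    have := Finset.card_filter_add_card_filter_not (s := Finset.univ)
      (fun i => zhouDingWord p m k π v i = 0)
    rw [Finset.card_univ, Fintype.card_fin] at this
    exact this
  have := Finset.card_erase_add_one h0
  omega

/-- The weights of the words `zhouDingWord`, together with the first two moments of the sign
distinguishing them. -/
theorem exists_sign_hammingNorm_zhouDingWord {m k : ℕ} (hp : Odd p) (hm : 0 < m)
    (hsodd : Odd (m / m.gcd k)) (hke : Odd (k / m.gcd k)) (hK : Fintype.card K = p ^ m)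
    {π : K} (hπ : IsPrimitiveRoot π (p ^ m - 1)) :
    ∃ ε : K × K → ℤ, (∀ v ≠ 0, ε v = 0 ∨ ε v = 1 ∨ ε v = -1) ∧
      (∀ v ≠ 0, (p : ℤ) * hammingNorm (zhouDingWord p m k π v)
        = (p - 1) * (p ^ m - ε v * p ^ ((m + m.gcd k) / 2))) ∧
      (∑ v ∈ Finset.univ.erase 0, ε v) * (p : ℤ) ^ ((m + m.gcd k) / 2)
        = p ^ m * (p ^ m - 1) ∧
      (∑ v ∈ Finset.univ.erase 0, ε v ^ 2) * ((p : ℤ) ^ ((m + m.gcd k) / 2)) ^ 2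
        = (p ^ m) ^ 2 * (p ^ m - 1) := by
  choose! ε hε hw using fun v (hv : v ≠ 0) =>
    walshSum_eq (p := p) (K := K) (m := m) (k := k) hp hm hsodd hke hK (v := v) hv
  -- The pair zero carries no sign; its Walsh sum is subtracted from the first moment, and its
  -- square from the second.
  have hw0 : walshSum p (p ^ k) (0 : K × K) 1 = p ^ m := by
    simp [walshSum, hK]
  refine ⟨ε, hε, fun v hv => ?_, ?_, ?_⟩
  · have h1 := mul_card_trace_eq_zero (p := p) (p ^ k) v
    have h2 := hammingNorm_zhouDingWord_add_card (k := k) hp hK hπ v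
    rw [Finset.sum_congr rfl (fun t ht => hw v hv t (Finset.ne_of_mem_erase ht)), Finset.sum_const,
      Finset.card_erase_of_mem (Finset.mem_univ _), Finset.card_univ, ZMod.card, nsmul_eq_mul, hK,
      Nat.cast_sub (Fact.out : p.Prime).one_le] at h1
    have h1' := h1
    push_cast at h1'
    have h3 := congrArg (Nat.cast : ℕ → ℂ) h2
    push_cast at h3
    have : (p : ℂ) * hammingNorm (zhouDingWord p m k π v)
        = (p - 1) * (p ^ m - ε v * p ^ ((m + m.gcd k) / 2)) := by
      linear_combination (p : ℂ) * h3 - h1'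
    exact_mod_cast this
  · have h1 := sum_walshSum (p := p) (K := K) (P := p ^ k) 1 one_ne_zero
    rw [← Finset.add_sum_erase _ _ (Finset.mem_univ 0), hw0, hK,
      Finset.sum_congr rfl (fun v hv => hw v (Finset.ne_of_mem_erase hv) 1 one_ne_zero),
      ← Finset.sum_mul] at h1
    have : (∑ v ∈ Finset.univ.erase 0, (ε v : ℂ)) * (p : ℂ) ^ ((m + m.gcd k) / 2)
        = p ^ m * (p ^ m - 1) := by
      push_cast at h1
      linear_combination h1
    exact_mod_cast this
  · have h1 := sum_walshSum_mul_conj (p := p) (K := K) (p ^ k) 1 one_ne_zero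
    rw [← Finset.add_sum_erase _ _ (Finset.mem_univ 0), hw0, hK,
      Finset.sum_congr rfl (g := fun v => (ε v : ℂ) ^ 2 * ((p : ℂ) ^ ((m + m.gcd k) / 2)) ^ 2)
        (fun v hv => by
          rw [hw v (Finset.ne_of_mem_erase hv) 1 one_ne_zero]
          simp only [map_mul, map_pow, map_natCast, map_intCast]; ring),
      ← Finset.sum_mul] at h1
    have : (∑ v ∈ Finset.univ.erase 0, (ε v : ℂ) ^ 2) * ((p : ℂ) ^ ((m + m.gcd k) / 2)) ^ 2
        = (p ^ m) ^ 2 * (p ^ m - 1) := by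
      simp only [map_pow, map_natCast] at h1
      push_cast at h1
      linear_combination h1
    exact_mod_cast this

end Weights

/-! ### The weight distribution -/

theorem sum_sign_eq {ι : Type*} (s : Finset ι) (ε : ι → ℤ)
    (h : ∀ v ∈ s, ε v = 0 ∨ ε v = 1 ∨ ε v = -1) :
    ∑ v ∈ s, ε v = (s.filter fun v => ε v = 1).card - (s.filter fun v => ε v = -1).card ∧
    ∑ v ∈ s, ε v ^ 2 = (s.filter fun v => ε v = 1).card + (s.filter fun v => ε v = -1).card ∧
    (s.card : ℤ) = (s.filter fun v => ε v = 0).card + (s.filter fun v => ε v = 1).card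
      + (s.filter fun v => ε v = -1).card := by
  simp only [Finset.card_eq_sum_ones, Finset.sum_filter, Nat.cast_sum]
  rw [← Finset.sum_sub_distrib, ← Finset.sum_add_distrib, ← Finset.sum_add_distrib,
    ← Finset.sum_add_distrib]
  refine ⟨?_, ?_, ?_⟩ <;> refine Finset.sum_congr rfl fun v hv => ?_ <;>
    rcases h v hv with h | h | h <;> simp [h]

set_option maxHeartbeats 400000 in
theorem theorem4 (p m k e s : ℕ) [Fact p.Prime] (hp : Odd p) (hm : 0 < m) (hk : 0 < k)
    (he : e = Nat.gcd m k) (hs : s = m / e) (hsodd : Odd s) (hs3 : 3 ≤ s)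
    (hke : Odd (k / e))
    {K : Type*} [Field K] [Finite K] [Algebra (ZMod p) K] (hK : Nat.card K = p ^ m)
    (π : K) (hπ : IsPrimitiveRoot π (p ^ m - 1)) :
    -- the parity-check polynomial divides `x^n - 1`, so the code is well defined
    zhouDingParityCheck p k π ∣ (Polynomial.X ^ (p ^ m - 1) - 1 : Polynomial (ZMod p)) ∧
    IsCyclicCode (zhouDingCode p m k π) ∧
    IsThreeWeightCode (zhouDingCode p m k π) ∧
    HasCodeParameters (zhouDingCode p m k π) (2 * m)
      (p ^ m - p ^ (m - 1) - (p - 1) * p ^ ((m + e - 2) / 2)) ∧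
    -- the weight distribution
    weightCount (zhouDingCode p m k π) 0 = 1 ∧
    (weightCount (zhouDingCode p m k π)
        (p ^ m - p ^ (m - 1) - (p - 1) * p ^ ((m + e - 2) / 2)) : ℚ) =
      1 / 2 * ((p : ℚ) ^ (m - e) + (p : ℚ) ^ ((m - e) / 2)) * ((p : ℚ) ^ m - 1) ∧
    (weightCount (zhouDingCode p m k π) (p ^ m - p ^ (m - 1)) : ℚ) =
      ((p : ℚ) ^ m - (p : ℚ) ^ (m - e) + 1) * ((p : ℚ) ^ m - 1) ∧
    (weightCount (zhouDingCode p m k π)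
        (p ^ m - p ^ (m - 1) + (p - 1) * p ^ ((m + e - 2) / 2)) : ℚ) =
      1 / 2 * ((p : ℚ) ^ (m - e) - (p : ℚ) ^ ((m - e) / 2)) * ((p : ℚ) ^ m - 1) ∧
    ∀ w : ℕ, w ≠ 0 →
      w ≠ p ^ m - p ^ (m - 1) - (p - 1) * p ^ ((m + e - 2) / 2) →
      w ≠ p ^ m - p ^ (m - 1) →
      w ≠ p ^ m - p ^ (m - 1) + (p - 1) * p ^ ((m + e - 2) / 2) →
      weightCount (zhouDingCode p m k π) w = 0 := by
  classical
  have : Fintype K := Fintype.ofFinite K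
  have hKc : Fintype.card K = p ^ m := by rw [← Nat.card_eq_fintype_card, hK]
  have hpp : p.Prime := Fact.out
  have hp3 : 3 ≤ p := by
    have := hpp.two_le
    obtain ⟨i, hi⟩ := hp
    omega
  have he0 : 0 < e := he ▸ Nat.gcd_pos_of_pos_left _ hm
  obtain ⟨ε, hε, hwt, hsum, hsum2⟩ := exists_sign_hammingNorm_zhouDingWord (p := p) (m := m)
    (k := k) hp hm (by rw [← he, ← hs]; exact hsodd) (by rwa [← he]) hKc hπ
  rw [← he] at hwt hsum hsum2
  obtain ⟨j, hj⟩ := hsodd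
  obtain ⟨f, hf⟩ : ∃ f, f = e * j := ⟨_, rfl⟩
  have hme : m = 2 * f + e := by
    have h1 : e * (m / e) = m := Nat.mul_div_cancel' (he ▸ Nat.gcd_dvd_left m k)
    rw [← hs, hj] at h1
    rw [hf, ← h1]; ring
  -- From `s ≥ 3`. It yields `Y > 1` below, so that all weights are positive and the largest one
  -- occurs.
  have hf0 : 0 < f := hf ▸ Nat.mul_pos he0 (by omega)
  rw [show (m + e) / 2 = f + e by omega] at hwt hsum hsum2
  rw [show (m + e - 2) / 2 = f + e - 1 by omega, show m - e = f + f by omega,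
    show (f + f) / 2 = f by omega]
  -- With `D = p ^ ((m + e - 2) / 2)` and `Y = p ^ ((m - e) / 2)`, the weights become `(p - 1) (Y D
  -- - ε D)`, and `p ^ m = p Y D`.
  set D := p ^ (f + e - 1) with hD
  set Y := p ^ f with hY
  have hDY : D = Y * p ^ (e - 1) := by rw [hD, hY, ← pow_add]; congr 1; omega
  have hA : p ^ (m - 1) = Y * D := by rw [hY, hD, ← pow_add]; congr 1; omega
  have hR : p ^ (f + e) = p * D := by rw [hD, ← pow_succ']; congr 1; omega
  have hq : p ^ m = p * (Y * D) := by rw [← hA, ← pow_succ']; congr 1; omega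
  have hY3 : 3 ≤ Y := hp3.trans (Nat.le_self_pow hf0.ne' p)
  have hYD : Y ≤ D := by
    rw [hDY]; exact Nat.le_mul_of_pos_right _ (pow_pos (by omega) _)
  have hD0 : 0 < D := by omega
  have hDA : D < Y * D := (Nat.lt_mul_iff_one_lt_left hD0).mpr (by omega)
  have hqZ : (p : ℤ) ^ m = p * (Y * D) := by exact_mod_cast hq
  have hRZ : (p : ℤ) ^ (f + e) = p * D := by exact_mod_cast hR
  have hpZ : (3 : ℤ) ≤ p := by exact_mod_cast hp3
  have hDZ : (0 : ℤ) < D := by exact_mod_cast hD0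
  have hDAZ : (D : ℤ) < Y * D := by exact_mod_cast hDA
  have hYZ : (3 : ℤ) ≤ Y := by exact_mod_cast hY3
  have hYDZ : (Y : ℤ) ≤ D := by exact_mod_cast hYD
  rw [hqZ, hRZ] at hsum hsum2
  have hpD : (p : ℤ) * D ≠ 0 := by positivity
  replace hsum : ∑ v ∈ Finset.univ.erase 0, ε v = Y * (p ^ m - 1) := by
    apply mul_right_cancel₀ hpD
    rw [hsum, hqZ]; ring
  replace hsum2 : ∑ v ∈ Finset.univ.erase 0, ε v ^ 2 = Y ^ 2 * (p ^ m - 1) := by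
    apply mul_right_cancel₀ (pow_ne_zero 2 hpD)
    rw [hsum2, hqZ]; ring
  replace hwt : ∀ v ≠ 0, (hammingNorm (zhouDingWord p m k π v) : ℤ)
      = (p - 1) * (Y * D - ε v * D) := by
    intro v hv
    have := hwt v hv
    rw [hqZ, hRZ] at this
    apply mul_left_cancel₀ (show (p : ℤ) ≠ 0 by omega)
    rw [this]; ring
  have hle : (p - 1) * D < p ^ m - p ^ (m - 1) := by
    rw [hq, hA, ← Nat.sub_one_mul]
    exact Nat.mul_lt_mul_of_pos_left hDA (by omega)
  have hle' : p ^ (m - 1) ≤ p ^ m := Nat.pow_le_pow_right (by omega) (by omega)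
  have hW1 : ((p ^ m - p ^ (m - 1) - (p - 1) * D : ℕ) : ℤ) = (p - 1) * (Y * D - 1 * D) := by
    rw [Nat.cast_sub hle.le, Nat.cast_sub hle', hq, hA]
    push_cast [Nat.cast_sub (show 1 ≤ p by omega)]
    ring
  have hW0 : ((p ^ m - p ^ (m - 1) : ℕ) : ℤ) = (p - 1) * (Y * D - 0 * D) := by
    rw [Nat.cast_sub hle', hq, hA]
    push_cast
    ring
  have hW2 : ((p ^ m - p ^ (m - 1) + (p - 1) * D : ℕ) : ℤ) = (p - 1) * (Y * D - (-1) * D) := by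
    rw [Nat.cast_add, hW0]
    push_cast [Nat.cast_sub (show 1 ≤ p by omega)]
    ring
  have hpD0 : 0 < (p - 1) * D := Nat.mul_pos (by omega) hD0
  generalize hw1 : p ^ m - p ^ (m - 1) - (p - 1) * D = w₁ at *
  generalize hw0 : p ^ m - p ^ (m - 1) = w₀ at *
  generalize hw2 : w₀ + (p - 1) * D = w₂ at *
  -- A nonzero pair has positive weight, since `ε ≤ 1 < Y`.
  have hinj : Function.Injective (zhouDingWord p m k π) := by
    rw [← LinearMap.ker_eq_bot, LinearMap.ker_eq_bot']
    intro v hv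
    by_contra hne
    have h1 := hwt v hne
    rw [hv, hammingNorm_zero] at h1
    have : (0 : ℤ) < Y * D - ε v * D := by
      rcases hε v hne with h | h | h <;> rw [h] <;> linarith
    have : (0 : ℤ) < (p - 1) * (Y * D - ε v * D) := mul_pos (by linarith) this
    rw [← h1] at this
    simp at this
  have hn1 : 1 < p ^ m := by rw [← hKc]; exact Fintype.one_lt_card
  have hnodd : Even (p ^ m - 1) := Nat.Odd.sub_odd hp.pow odd_one
  obtain ⟨hdvd, hC⟩ := cyclicCodeOfParityCheck_minpoly_mul_minpoly (F := ZMod p) (n := p ^ m - 1)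
    (by omega) (α := -π) (β := π ^ ((p ^ k + 1) / 2)) (by rw [hnodd.neg_pow, hπ.pow_eq_one])
    (by rw [← pow_mul, mul_comm, pow_mul, hπ.pow_eq_one, one_pow]) hinj
  replace hC : zhouDingCode p m k π = (zhouDingWord p m k π).range := hC
  have hcount : ∀ w, weightCount (zhouDingCode p m k π) w
      = (Finset.univ.filter fun v => hammingNorm (zhouDingWord p m k π v) = w).card := by
    intro w
    rw [weightCount, hC, ← Set.ncard_coe_finset, ← Set.ncard_image_of_injective _ hinj]
    congr 1
    ext c
    simp only [Set.mem_ofPred_eq, LinearMap.mem_range, Set.mem_image, Finset.coe_filter,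
      Finset.mem_univ, true_and]
    constructor
    · rintro ⟨⟨v, rfl⟩, h⟩; exact ⟨v, h, rfl⟩
    · rintro ⟨v, h, rfl⟩; exact ⟨⟨v, rfl⟩, h⟩
  have hiff : ∀ v ≠ 0, ∀ (w : ℕ) (c : ℤ), (w : ℤ) = (p - 1) * (Y * D - c * D) →
      (hammingNorm (zhouDingWord p m k π v) = w ↔ ε v = c) := by
    intro v hv w c hw
    rw [← Nat.cast_inj (R := ℤ), hwt v hv, hw, mul_right_inj' (by linarith), sub_right_inj,
      mul_left_inj' hDZ.ne']
  have hcount' : ∀ (w : ℕ) (c : ℤ), w ≠ 0 → (w : ℤ) = (p - 1) * (Y * D - c * D) →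
      weightCount (zhouDingCode p m k π) w
        = ((Finset.univ.erase (0 : K × K)).filter fun v => ε v = c).card := by
    intro w c hw0 hw
    rw [hcount]
    congr 1
    ext v
    by_cases hv : v = 0
    · subst hv; simp [Ne.symm hw0]
    · simp [hv, hiff v hv w c hw]
  -- Three linear equations for the frequencies: `A₁ - A₂ = Y (p ^ m - 1)`, `A₁ + A₂ = Y² (p ^ m -
  -- 1)` and `A₀ + A₁ + A₂ = p ^ (2 m) - 1`.
  obtain ⟨h1, h2, h3⟩ := sum_sign_eq (Finset.univ.erase (0 : K × K)) ε
    fun v hv => hε v (Finset.ne_of_mem_erase hv)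
  rw [Finset.card_erase_of_mem (Finset.mem_univ _), Finset.card_univ, Fintype.card_prod, hKc,
    Nat.cast_sub (Nat.mul_pos (by omega) (by omega))] at h3
  push_cast at h3
  rw [hsum] at h1
  rw [hsum2] at h2
  have hw₁ : w₁ ≠ 0 := by omega
  have hw₀ : w₀ ≠ 0 := by omega
  have hw₂ : w₂ ≠ 0 := by omega
  rw [← hcount' w₁ 1 hw₁ hW1, ← hcount' w₂ (-1) hw₂ hW2] at h1 h2 h3
  rw [← hcount' w₀ 0 hw₀ hW0] at h3
  have hQ1 : (2 * weightCount (zhouDingCode p m k π) w₁ : ℤ) = (Y ^ 2 + Y) * (p ^ m - 1) := by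
    linear_combination -h1 - h2
  have hQ2 : (2 * weightCount (zhouDingCode p m k π) w₂ : ℤ) = (Y ^ 2 - Y) * (p ^ m - 1) := by
    linear_combination h1 - h2
  have hQ0 : (weightCount (zhouDingCode p m k π) w₀ : ℤ) = (p ^ m - Y ^ 2 + 1) * (p ^ m - 1) := by
    linear_combination h2 - h3
  have hn1Z : (0 : ℤ) < p ^ m - 1 := by
    have : (1 : ℤ) < p ^ m := by exact_mod_cast hn1
    linarith
  have hex : ∀ w, weightCount (zhouDingCode p m k π) w ≠ 0 →
      ∃ v, hammingNorm (zhouDingWord p m k π v) = w := by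
    intro w hw
    rw [hcount] at hw
    obtain ⟨v, hv⟩ := Finset.card_ne_zero.mp hw
    exact ⟨v, (Finset.mem_filter.mp hv).2⟩
  obtain ⟨v₁, hv₁⟩ := hex w₁ fun h => by
    rw [h] at hQ1
    have : (0 : ℤ) < (Y ^ 2 + Y) * (p ^ m - 1) := mul_pos (by positivity) hn1Z
    simp only [Nat.cast_zero, mul_zero] at hQ1
    linarith
  obtain ⟨v₂, hv₂⟩ := hex w₂ fun h => by
    rw [h] at hQ2
    have : (0 : ℤ) < (Y ^ 2 - Y) * (p ^ m - 1) := mul_pos (by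
      have : 1 * (Y : ℤ) < Y * Y := mul_lt_mul_of_pos_right (by linarith) (by linarith)
      rw [pow_two]; linarith) hn1Z
    simp only [Nat.cast_zero, mul_zero] at hQ2
    linarith
  obtain ⟨v₀, hv₀⟩ := hex w₀ fun h => by
    rw [h] at hQ0
    have : (0 : ℤ) < (p ^ m - Y ^ 2 + 1) * (p ^ m - 1) := by
      refine mul_pos ?_ hn1Z
      have h4 : (Y : ℤ) * Y ≤ Y * D := mul_le_mul_of_nonneg_left hYDZ (by linarith)
      have h5 : 1 * ((Y : ℤ) * D) ≤ p * (Y * D) :=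
        mul_le_mul_of_nonneg_right (by linarith) (by positivity)
      rw [hqZ, pow_two]
      linarith
    simp only [Nat.cast_zero] at hQ0
    linarith
  have hweights : ∀ v ≠ 0, hammingNorm (zhouDingWord p m k π v) = w₁ ∨
      hammingNorm (zhouDingWord p m k π v) = w₀ ∨ hammingNorm (zhouDingWord p m k π v) = w₂ := by
    intro v hv
    rcases hε v hv with h | h | h
    · exact Or.inr (Or.inl ((hiff v hv _ _ hW0).mpr h))
    · exact Or.inl ((hiff v hv _ _ hW1).mpr h)
    · exact Or.inr (Or.inr ((hiff v hv _ _ hW2).mpr h))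
  refine ⟨hdvd, isCyclicCode_cyclicCodeOfParityCheck _, ?_, ⟨?_, ?_, ?_⟩, ?_, ?_, ?_, ?_, ?_⟩
  · have hset : {w : ℕ | w ≠ 0 ∧ ∃ c ∈ zhouDingCode p m k π, hammingNorm c = w} = {w₁, w₀, w₂} := by
      rw [hC]
      ext w
      simp only [Set.mem_ofPred_eq, Set.mem_insert_iff, Set.mem_singleton_iff]
      constructor
      · rintro ⟨hw, _, ⟨v, rfl⟩, rfl⟩
        exact hweights v fun h => hw (by rw [h, map_zero, hammingNorm_zero])
      · rintro (rfl | rfl | rfl)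
        exacts [⟨hw₁, _, ⟨v₁, rfl⟩, hv₁⟩, ⟨hw₀, _, ⟨v₀, rfl⟩, hv₀⟩, ⟨hw₂, _, ⟨v₂, rfl⟩, hv₂⟩]
    rw [IsThreeWeightCode, hset, Set.ncard_eq_three]
    exact ⟨w₁, w₀, w₂, by omega, by omega, by omega, rfl⟩
  · rw [hC, LinearMap.finrank_range_of_inj hinj, Module.finrank_prod]
    have := (FiniteField.pow_finrank_eq_card p K).trans hKc
    rw [Nat.pow_right_injective hpp.two_le this]; ring
  · rw [hC]
    refine ⟨_, ⟨v₁, rfl⟩, 0, zero_mem _, fun h => hw₁ ?_, ?_⟩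
    · rw [← hv₁, h, hammingNorm_zero]
    · rw [hammingDist_zero_right, hv₁]
  · rw [hC]
    rintro _ ⟨_, ⟨u, rfl⟩, _, ⟨v, rfl⟩, huv, rfl⟩
    rw [hammingDist_eq_hammingNorm, neg_add_eq_sub, ← map_sub]
    rcases hweights (v - u) fun h => huv (by rw [sub_eq_zero.mp h]) with h | h | h <;> omega
  · rw [hcount, Finset.card_eq_one]
    refine ⟨0, ?_⟩
    ext v
    simp only [Finset.mem_filter, Finset.mem_univ, true_and, Finset.mem_singleton,
      hammingNorm_eq_zero]
    exact map_eq_zero_iff _ hinj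
  · have := congrArg (Int.cast : ℤ → ℚ) hQ1
    push_cast [hY] at this ⊢
    rw [pow_add]
    linear_combination this / 2
  · have := congrArg (Int.cast : ℤ → ℚ) hQ0
    push_cast [hY] at this ⊢
    rw [pow_add]
    linear_combination this
  · have := congrArg (Int.cast : ℤ → ℚ) hQ2
    push_cast [hY] at this ⊢
    rw [pow_add]
    linear_combination this / 2
  · intro w hw h₁ h₀ h₂
    rw [hcount, Finset.card_eq_zero, Finset.filter_eq_empty_iff]
    intro v _ hv
    rcases hweights v fun h => hw (by rw [← hv, h, map_zero, hammingNorm_zero]) with h | h | h <;>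
      omega
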